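/- **Setting.** Let $\mathcal V=(\mathcal V,\otimes,k)$ be a commutative unital quantale with internal hom $u\otimes v\le w\iff v\le\hom(u,w)$. Let $(U,e,m)$ be the ultrafilter monad on sets, and let $\xi:U\mathcal V\to\mathcal V$ be a *strict ultrafilter theory*, that is: - $\xi\cdot e_{\mathcal V}=1$ and $\xi\cdot U\xi=\xi\cdot m_{\mathcal V}$; - $\xi\cdot U(\otimes)=\otimes\cdot\langle\xi\cdot U\pi_1,\xi\cdot U\pi_2\rangle$ on $U(\mathcal V\times\mathcal V)$; - for all maps $f:X\to Y$, $\varphi:X\to\mathcal V$ and all $\mathfrak y\in UY$, $\ \xi\cdot U(f_!\varphi)(\mathfrak y)=\bigvee\{\xi\cdot U\varphi(\mathfrak x)\mid \mathfrak x\in UX,\ Uf(\mathfrak x)=\mathfrak y\}$, where $f_!\varphi(y)=\bigvee_{f(x)=y}\varphi(x)$. Assume moreover that the theory is *compatible with finite suprema*, i.e. $\xi\cdot U(\vee)=\vee\cdot\langle\xi\cdot U\pi_1,\xi\cdot U\pi_2\rangle$; that $k$ is the top element of $\mathcal V$; and that $k$ is *approximated*, i.e. $\{u\mid u\ll k\}$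 is directed (in particular non-empty) with supremum $k$, where $u\ll v$ means that every down set $A\subseteq\mathcal V$ with $v\le\bigvee A$ contains $u$. **Definitions.** A $\mathcal V$-relation $r$ from $X$ to $Y$ is a map $X\times Y\to\mathcal V$, with composition $(s\cdot r)(x,z)=\bigvee_y r(x,y)\otimes s(y,z)$; maps are regarded as $\mathcal V$-relations, with values $k$ (on the graph) and $\bot$, and $r^\circ$ is the opposite of $r$. Put $U_\xi r(\mathfrak x,\mathfrak y)=\bigvee\{\xi\cdot Ur(\mathfrak w)\mid \mathfrak w\in U(X\times Y),\ U\pi_X(\mathfrak w)=\mathfrak x,\ U\pi_Y(\mathfrak w)=\mathfrak y\}$. For $\varphi:UX\times Y\to\mathcal V$ and $\psi:UY\times Z\to\mathcal V$ put $\psi\circ\varphi=\psi\cdot U_\xi\varphi\cdot m_X^\circ$. - A *$\mathcal V$-category* $(X,a)$ is a set with $a:X\times X\to\mathcal V$, $1_X\le a$, $a\cdot a\le a$. A *$\mathcal V$-distributor* $(X,a)\to(Y,b)$ is a $\mathcal V$-relation $\varphi$ from $X$ to $Y$ with $\varphi\cdot a\le\varphi$ and $b\cdot\varphi\le\varphi$.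 - A *$\mathbb U$-category* $(X,a)$ is a set with $a:UX\times X\to\mathcal V$, $1_X\le a\cdot e_X$ and $a\cdot U_\xi a\le a\cdot m_X$; its underlying $\mathcal V$-category is $X_0=(X,a\cdot e_X)$. A *$\mathbb U$-distributor* $(X,a)\to(Y,b)$ is a map $\varphi:UX\times Y\to\mathcal V$ with $\varphi\circ a\le\varphi$ and $b\circ\varphi\le\varphi$. It is *left adjoint* if there is a $\mathbb U$-distributor $\psi:(Y,b)\to(X,a)$ such that $\psi\circ\varphi$ and $\varphi\circ\psi$ are $\mathbb U$-distributors, $a\le\psi\circ\varphi$ and $\varphi\circ\psi\le b$. - $G=(1,k)$ denotes the one-point $\mathcal V$-category, respectively $\mathbb U$-category, with constant structure $k$. Since $U1\cong 1$, $\mathcal V$-distributors $G\to X_0$ and $\mathbb U$-distributors $G\to X$ are both identified with maps $X\to\mathcal V$, and every $\mathbb U$-distributor $G\to X$ is a $\mathcal V$-distributor $G\to X_0$. Put $[\varphi,\varphi']=\bigwedge_{x\in X}\hom(\varphi(x),\varphi'(x))$. - A $\mathcal V$-distributor $\varphi:G\to X_0$ is *codirected* if $[\varphi,\bot]=\bot$,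 $[\varphi,\varphi_1\vee\varphi_2]=[\varphi,\varphi_1]\vee[\varphi,\varphi_2]$ and $[\varphi,u\otimes\varphi_1]=u\otimes[\varphi,\varphi_1]$ for all $\mathcal V$-distributors $\varphi_1,\varphi_2:G\to X_0$ and all $u\in\mathcal V$. **Statement.** Let $X=(X,a)$ be a $\mathbb U$-category and let $\varphi:G\to X_0$ be a codirected $\mathcal V$-distributor. Let $\overline\varphi$ be the infimum of all $\mathbb U$-distributors $G\to X$ above $\varphi$. Then $\overline\varphi$ is the reflection of $\varphi$ into $\mathbb U$-distributors, i.e. $\overline\varphi:G\to X$ is a $\mathbb U$-distributor and $[\overline\varphi,\theta]=[\varphi,\theta]$ for every $\mathbb U$-distributor $\theta:G\to X$; and $\overline\varphi$ is a left adjoint $\mathbb U$-distributor. -/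

import Mathlib

universe u v w t

open scoped Quantale

namespace UTheory

/-! ### Quantales

A (commutative, unital) quantale is a type `V` with instances `CommMonoid V`, `CompleteLattice V`
and `IsQuantale V`: the tensor is `*`, its neutral element `k` is `1`, and the internal hom
`hom(x, y)` is `x ⇨ᵣ y`, characterised by `z ≤ x ⇨ᵣ y ↔ x * z ≤ y`. -/

/-- `x` is totally below `y`: every down set whose supremum is above `y` contains `x`. -/
def TotallyBelow {V : Type u} [CompleteLattice V] (x y : V) : Prop :=
  ∀ A : Set V, IsLowerSet A → y ≤ sSup A → x ∈ A

/-- The set of all elements totally below `y` is directed (so in particular non-empty), and `y`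
is its supremum. -/
def Approximated {V : Type u} [CompleteLattice V] (y : V) : Prop :=
  {x : V | TotallyBelow x y}.Nonempty ∧
  DirectedOn (· ≤ ·) {x : V | TotallyBelow x y} ∧
  y = sSup {x : V | TotallyBelow x y}

/-! ### The ultrafilter monad

The functor is `Ultrafilter` with `Ultrafilter.map`, the unit is `pure`. -/

/-- The multiplication `UUX → UX` of the ultrafilter monad. -/
def mult {X : Type u} (F : Ultrafilter (Ultrafilter X)) : Ultrafilter X :=
  F.bind id

theorem mem_mult {X : Type u} (F : Ultrafilter (Ultrafilter X)) (A : Set X) :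
    A ∈ mult F ↔ {p : Ultrafilter X | A ∈ p} ∈ F :=
  Iff.rfl

/-! ### Ultrafilter theories -/

section Theories

variable {V : Type u} [CommMonoid V] [CompleteLattice V]

/-- An ultrafilter theory on the quantale `V`: a map `ξ : UV → V` which is an Eilenberg–Moore
algebra for the ultrafilter monad, for which the tensor is laxly continuous, and which is
compatible with suprema. -/
structure IsUltrafilterTheory (ξ : Ultrafilter V → V) : Prop where
  unit : ∀ x : V, ξ (pure x) = x
  assoc : ∀ F : Ultrafilter (Ultrafilter V), ξ (F.map ξ) = ξ (mult F)
  tensor_le : ∀ q : Ultrafilter (V × V),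
    ξ (q.map Prod.fst) * ξ (q.map Prod.snd) ≤ ξ (q.map fun p => p.1 * p.2)
  /-- Naturality in the set `X` of `V ^ X → V ^ UX`, `φ ↦ ξ ∘ Uφ`, where a map `f : X → Y` acts by
  sending `φ : X → V` to `y ↦ ⨆ {φ x | f x = y}`. -/
  iSup_eq : ∀ (X Y : Type u) (f : X → Y) (φ : X → V) (q : Ultrafilter Y),
    ξ (q.map fun y => ⨆ x : {x : X // f x = y}, φ x) =
      ⨆ p : {p : Ultrafilter X // p.map f = q}, ξ (p.1.map φ)

/-- A strict ultrafilter theory: the tensor is continuous. -/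
structure IsStrictUltrafilterTheory (ξ : Ultrafilter V → V) : Prop
    extends IsUltrafilterTheory ξ where
  tensor_eq : ∀ q : Ultrafilter (V × V),
    ξ (q.map fun p => p.1 * p.2) = ξ (q.map Prod.fst) * ξ (q.map Prod.snd)

/-- Compatibility with finite suprema: binary suprema are continuous. -/
def CompatibleWithFiniteSuprema (ξ : Ultrafilter V → V) : Prop :=
  ∀ q : Ultrafilter (V × V),
    ξ (q.map fun p => p.1 ⊔ p.2) = ξ (q.map Prod.fst) ⊔ ξ (q.map Prod.snd)

end Theories

/-! ### Quantale-valued relations -/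

/-- `V`-relations from `X` to `Y`, ordered pointwise. -/
abbrev VRel (V : Type u) (X : Type v) (Y : Type w) := X → Y → V

section Relations

variable {V : Type u} [CommMonoid V] [CompleteLattice V]

/-- The composite `s · r` of `r` from `X` to `Y` with `s` from `Y` to `Z`. -/
def comp {X : Type v} {Y : Type w} {Z : Type t} (s : VRel V Y Z) (r : VRel V X Y) : VRel V X Z :=
  fun x z => ⨆ y, r x y * s y z

open Classical in
/-- A map, seen as a `V`-relation. -/
noncomputable def graph {X : Type v} {Y : Type w} (f : X → Y) : VRel V X Y :=
  fun x y => if f x = y then 1 else ⊥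

/-- The opposite `V`-relation. -/
def conv {X : Type v} {Y : Type w} (r : VRel V X Y) : VRel V Y X :=
  fun y x => r x y

/-- The extension of a `V`-relation from `X` to `Y` to one from `UX` to `UY`. -/
def uExt (ξ : Ultrafilter V → V) {X : Type v} {Y : Type w} (r : VRel V X Y) :
    VRel V (Ultrafilter X) (Ultrafilter Y) :=
  fun p q => ⨆ z : {z : Ultrafilter (X × Y) // z.map Prod.fst = p ∧ z.map Prod.snd = q},
    ξ (z.1.map fun c => r c.1 c.2)

/-- The Kleisli composite `ψ · Uφ · m°` of the `U`-relations `φ` from `X` to `Y` and `ψ` from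
`Y` to `Z`. -/
noncomputable def kleisli (ξ : Ultrafilter V → V) {X : Type v} {Y : Type w} {Z : Type t}
    (ψ : VRel V (Ultrafilter Y) Z) (φ : VRel V (Ultrafilter X) Y) : VRel V (Ultrafilter X) Z :=
  comp ψ (comp (uExt ξ φ) (conv (graph mult)))

/-! ### Categories and distributors -/

/-- `(X, a)` is a `V`-category. -/
def IsVCat {X : Type v} (a : VRel V X X) : Prop :=
  graph id ≤ a ∧ comp a a ≤ a

/-- `φ` is a `V`-distributor from `(X, a)` to `(Y, b)`. -/
def IsVDist {X : Type v} {Y : Type w} (a : VRel V X X) (b : VRel V Y Y) (φ : VRel V X Y) : Prop :=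
  comp φ a ≤ φ ∧ comp b φ ≤ φ

/-- `(X, a)` is a `U`-category. -/
def IsUCat (ξ : Ultrafilter V → V) {X : Type v} (a : VRel V (Ultrafilter X) X) : Prop :=
  graph id ≤ comp a (graph pure) ∧ comp a (uExt ξ a) ≤ comp a (graph mult)

/-- `φ` is a `U`-distributor from `(X, a)` to `(Y, b)`. -/
def IsUDist (ξ : Ultrafilter V → V) {X : Type v} {Y : Type w}
    (a : VRel V (Ultrafilter X) X) (b : VRel V (Ultrafilter Y) Y)
    (φ : VRel V (Ultrafilter X) Y) : Prop :=
  kleisli ξ φ a ≤ φ ∧ kleisli ξ b φ ≤ φ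

/-- `φ`, from `(X, a)` to `(Y, b)`, is left adjoint to `ψ`, from `(Y, b)` to `(X, a)`, among
`U`-distributors. -/
structure IsUAdjunction (ξ : Ultrafilter V → V) {X : Type v} {Y : Type w}
    (a : VRel V (Ultrafilter X) X) (b : VRel V (Ultrafilter Y) Y)
    (φ : VRel V (Ultrafilter X) Y) (ψ : VRel V (Ultrafilter Y) X) : Prop where
  left_dist : IsUDist ξ a b φ
  right_dist : IsUDist ξ b a ψ
  comp_left_dist : IsUDist ξ a a (kleisli ξ ψ φ)
  comp_right_dist : IsUDist ξ b b (kleisli ξ φ ψ)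
  unit_le : a ≤ kleisli ξ ψ φ
  counit_le : kleisli ξ φ ψ ≤ b

/-- `φ` is a left adjoint `U`-distributor from `(X, a)` to `(Y, b)`. -/
def IsLeftAdjointUDist (ξ : Ultrafilter V → V) {X : Type v} {Y : Type w}
    (a : VRel V (Ultrafilter X) X) (b : VRel V (Ultrafilter Y) Y)
    (φ : VRel V (Ultrafilter X) Y) : Prop :=
  ∃ ψ : VRel V (Ultrafilter Y) X, IsUAdjunction ξ a b φ ψ

/-- The `V`-category `G = (1, k)`. -/
def vUnit (V : Type u) [CommMonoid V] : VRel V Unit Unit := fun _ _ => 1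

/-- The `U`-category `G = (1, k)`. -/
def uUnit (V : Type u) [CommMonoid V] : VRel V (Ultrafilter Unit) Unit := fun _ _ => 1

/-- Composition of a `U`-relation with the unit of the ultrafilter monad. For a `U`-category
`(X, a)` this yields the structure of its underlying `V`-category `X₀`; for a `U`-distributor from
`G` to `X` it yields the same map `X → V`, seen as a `V`-distributor from `G` to `X₀`. -/
noncomputable def under {X : Type v} {Y : Type w} (r : VRel V (Ultrafilter X) Y) : VRel V X Y :=
  comp r (graph pure)

/-! ### Codirected distributors and the reflection -/

/-- The hom `[φ, φ']` of the `V`-category of `V`-distributors from `G` to `X`. -/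
def bracket {X : Type v} (φ φ' : VRel V Unit X) : V :=
  ⨅ x, φ () x ⇨ᵣ φ' () x

/-- `φ` is a codirected `V`-distributor from `G` to `(X, a)`: it is a `V`-distributor and `[φ, -]`
preserves finite suprema and tensors of `V`-distributors. -/
structure IsCodirected {X : Type v} (a : VRel V X X) (φ : VRel V Unit X) : Prop where
  dist : IsVDist (vUnit V) a φ
  bracket_bot : bracket φ ⊥ = ⊥
  bracket_sup : ∀ φ₁ φ₂ : VRel V Unit X, IsVDist (vUnit V) a φ₁ → IsVDist (vUnit V) a φ₂ →
    bracket φ (φ₁ ⊔ φ₂) = bracket φ φ₁ ⊔ bracket φ φ₂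
  bracket_tensor : ∀ (x : V) (φ₁ : VRel V Unit X), IsVDist (vUnit V) a φ₁ →
    bracket φ (fun i y => x * φ₁ i y) = x * bracket φ φ₁

/-- The least `U`-distributor from `G` to `(X, a)` above the `V`-distributor `φ` from `G` to
`X₀`. -/
noncomputable def reflection (ξ : Ultrafilter V → V) {X : Type v}
    (a : VRel V (Ultrafilter X) X) (φ : VRel V Unit X) : VRel V (Ultrafilter Unit) X :=
  sInf {θ | IsUDist ξ (uUnit V) a θ ∧ φ ≤ under θ}

/-- `φ'` is the value at `φ` of the left adjoint to the inclusion `V`-functor from the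
`V`-category of `U`-distributors from `G` to `X` into the `V`-category of `V`-distributors from
`G` to `X₀`. -/
structure IsReflection (ξ : Ultrafilter V → V) {X : Type v} (a : VRel V (Ultrafilter X) X)
    (φ : VRel V Unit X) (φ' : VRel V (Ultrafilter Unit) X) : Prop where
  dist : IsUDist ξ (uUnit V) a φ'
  bracket_eq : ∀ θ : VRel V (Ultrafilter Unit) X, IsUDist ξ (uUnit V) a θ →
    bracket (under φ') (under θ) = bracket φ (under θ)

end Relations

end UTheory

open UTheory

namespace UTheory

/-! Since k is top and U1 is a point, a U-distributor G → X is just a map θ with ξ·Uθ(p) ⊗ a(p,x) ≤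
θ(x). Such maps are closed under infima (ξ is monotone) and under cotensors hom(u, θ) (strictness).
Taking u = [φ, θ], the inequality φ ≤ hom(u, θ) passes to the reflection, which gives the bracket
equation. The right adjoint is ψ(p) = [φ, a(p,-)]. The counit holds because a(p,-) is itself a
U-distributor, so φ may be replaced by its reflection in the bracket. None of this uses
codirectedness. Codirectedness enters for the unit, through an ultrafilter p with k ≤ ξ·Uφ(p) and φ
≤ a(p,-) (`IsCodirected.exists_ultrafilter`). Put μ(A) = [φ, closure of φ restricted to A]. Then
μ(∅) = ⊥, μ(A ∪ B) = μ(A) ∨ μ(B) and μ(X) = k. As k is join-prime and not ⊥, the sets whose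
complement has μ ≠ k form a proper filter, and every member of an ultrafilter p refining it has μ =
k. Approximation of k gives the first property of p; compatibility of ξ with suprema and
transitivity of a give the second. -/

instance {X : Type v} [Subsingleton X] : Subsingleton (Ultrafilter X) :=
  ⟨fun p q => Ultrafilter.ext fun A => by
    rcases A.eq_empty_or_nonempty with rfl | hA
    · simp
    · rw [Subsingleton.eq_univ_of_nonempty hA]
      exact iff_of_true Filter.univ_mem Filter.univ_mem⟩

/-! ### The algebra `ξ` and filters -/

section Algebra

variable {V : Type u} [CommMonoid V] [CompleteLattice V] {ξ : Ultrafilter V → V}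

theorem map_eq_pure_of_mem {X : Type v} {Y : Type w} {p : Ultrafilter X} {f : X → Y} {y : Y}
    (h : {x | f x = y} ∈ p) : p.map f = pure y := by
  refine Ultrafilter.eq_of_le ?_
  rw [Ultrafilter.coe_pure, Filter.le_pure_iff]
  exact h

theorem map_const_eq_pure {X : Type v} {Y : Type w} (p : Ultrafilter X) (y : Y) :
    (p.map fun _ => y) = pure y :=
  map_eq_pure_of_mem (Filter.mem_of_superset Filter.univ_mem fun _ _ => rfl)

theorem xi_map_const (hξ : IsUltrafilterTheory ξ) {X : Type v} (p : Ultrafilter X) (c : V) :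
    ξ (p.map fun _ => c) = c := by
  rw [map_const_eq_pure, hξ.unit]

theorem xi_map_pure (hξ : IsUltrafilterTheory ξ) {X : Type v} (f : X → V) (x : X) :
    ξ ((pure x : Ultrafilter X).map f) = f x := by
  rw [Ultrafilter.map_pure, hξ.unit]

omit [CommMonoid V] in
theorem xi_map_sup (hsup : CompatibleWithFiniteSuprema ξ) {X : Type v} (p : Ultrafilter X)
    (f g : X → V) : ξ (p.map fun x => f x ⊔ g x) = ξ (p.map f) ⊔ ξ (p.map g) := by
  have h := hsup (p.map fun x => (f x, g x))
  simpa only [Ultrafilter.map_map, Function.comp_def] using h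

theorem xi_map_mul (hξ : IsStrictUltrafilterTheory ξ) {X : Type v} (p : Ultrafilter X)
    (f g : X → V) : ξ (p.map fun x => f x * g x) = ξ (p.map f) * ξ (p.map g) := by
  have h := hξ.tensor_eq (p.map fun x => (f x, g x))
  simpa only [Ultrafilter.map_map, Function.comp_def] using h

-- Monotonicity of ξ is not assumed; it comes from reading f ≤ g as the equation f ∨ g = g.
omit [CommMonoid V] in
theorem xi_map_mono (hsup : CompatibleWithFiniteSuprema ξ) {X : Type v} (p : Ultrafilter X)
    {f g : X → V} (h : ∀ x, f x ≤ g x) : ξ (p.map f) ≤ ξ (p.map g) := by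
  have := xi_map_sup hsup p f g
  simp only [sup_eq_right.2 (h _)] at this
  exact sup_eq_right.1 this.symm

omit [CommMonoid V] [CompleteLattice V] in
theorem xi_map_congr {X : Type v} {p : Ultrafilter X} {f g : X → V} (h : {x | f x = g x} ∈ p) :
    ξ (p.map f) = ξ (p.map g) := by
  congr 1
  exact Ultrafilter.coe_injective (Filter.map_congr h)

theorem xi_map_le (hξ : IsUltrafilterTheory ξ) (hsup : CompatibleWithFiniteSuprema ξ)
    {X : Type v} {p : Ultrafilter X} {f : X → V} {c : V} (h : {x | f x ≤ c} ∈ p) :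
    ξ (p.map f) ≤ c := by
  have h₁ := xi_map_sup hsup p f fun _ => c
  rw [xi_map_const hξ, xi_map_congr (ξ := ξ) (g := fun _ => c), xi_map_const hξ] at h₁
  · exact sup_eq_right.1 h₁.symm
  · simpa only [sup_eq_right] using h

theorem le_xi_map (hξ : IsUltrafilterTheory ξ) (hsup : CompatibleWithFiniteSuprema ξ)
    {X : Type v} {p : Ultrafilter X} {f : X → V} {c : V} (h : {x | c ≤ f x} ∈ p) :
    c ≤ ξ (p.map f) := by
  have h₁ := xi_map_sup hsup p f fun _ => c
  rw [xi_map_const hξ, xi_map_congr (ξ := ξ) (g := f)] at h₁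
  · exact sup_eq_left.1 h₁.symm
  · simpa only [sup_eq_left] using h

/-- The infimum of the suprema of `f` over the members of a filter is attained by `ξ ∘ Uf` on
the ultrafilters refining it. -/
theorem iInf_iSup_le_iSup_xi (hξ : IsUltrafilterTheory ξ) (hsup : CompatibleWithFiniteSuprema ξ)
    {Y : Type u} (F : Filter Y) (f : Y → V) :
    ⨅ A ∈ F, ⨆ y ∈ A, f y ≤ ⨆ p : {p : Ultrafilter Y // (p : Filter Y) ≤ F}, ξ (p.1.map f) := by
  have hne : (F.smallSets ⊓ Filter.principal {A | A ∈ F}).NeBot :=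
    Filter.frequently_mem_iff_neBot.1 (Filter.frequently_smallSets_mem F)
  -- q lives on sets: it contains the family F itself and, for each A in F, the family of subsets of
  -- A. Naturality of ξ is then applied to the projection (A, y) ↦ A of the membership relation.
  obtain ⟨q, hq⟩ := Ultrafilter.exists_le (F.smallSets ⊓ Filter.principal {A | A ∈ F})
  have hqF : {A | A ∈ F} ∈ q := (hq.trans inf_le_right) (Filter.mem_principal_self _)
  have key := hξ.iSup_eq {c : Set Y × Y // c.2 ∈ c.1} (Set Y) (fun c => c.1.1)
    (fun c => f c.1.2) q
  have hle : ⨅ A ∈ F, ⨆ y ∈ A, f y ≤ ξ (q.map fun A =>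
      ⨆ c : {c : {c : Set Y × Y // c.2 ∈ c.1} // c.1.1 = A}, f c.1.1.2) := by
    refine le_xi_map hξ hsup (Filter.mem_of_superset hqF fun A hA => ?_)
    refine (iInf₂_le A hA).trans (iSup₂_le fun y hy => ?_)
    exact le_iSup (fun c : {c : {c : Set Y × Y // c.2 ∈ c.1} // c.1.1 = A} => f c.1.1.2)
      ⟨⟨(A, y), hy⟩, rfl⟩
  rw [key] at hle
  refine hle.trans (iSup_le fun P => ?_)
  -- A lift of q picks points of arbitrarily small sets, so its image in Y refines F.
  have hP : ((P.1.map fun c => c.1.2 : Ultrafilter Y) : Filter Y) ≤ F := by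
    intro A hA
    have h₁ : {B : Set Y | B ⊆ A} ∈ q :=
      (hq.trans inf_le_left) (Filter.eventually_smallSets.2 ⟨A, hA, fun _ hB => hB⟩)
    rw [← P.2] at h₁
    have h₂ : {c : {c : Set Y × Y // c.2 ∈ c.1} | c.1.1 ⊆ A} ∈ P.1 := h₁
    exact Ultrafilter.mem_map.2 (Filter.mem_of_superset h₂ fun c hc => hc c.2)
  exact le_iSup (fun p : {p : Ultrafilter Y // (p : Filter Y) ≤ F} => ξ (p.1.map f))
    ⟨P.1.map fun c => c.1.2, hP⟩

theorem mult_pure {X : Type u} (p : Ultrafilter X) : mult (pure p) = p :=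
  Ultrafilter.ext fun A => by rw [mem_mult, Ultrafilter.mem_pure]; rfl

end Algebra

/-! ### Totally below elements -/

section Approximation

variable {V : Type u} [CompleteLattice V] {k : V}

theorem TotallyBelow.le_or_le {x v w : V} (h : TotallyBelow x (v ⊔ w)) : x ≤ v ∨ x ≤ w :=
  h (Set.Iic v ∪ Set.Iic w) ((isLowerSet_Iic v).union (isLowerSet_Iic w))
    (sup_le (le_sSup (Or.inl le_rfl)) (le_sSup (Or.inr le_rfl)))

/-- The elements not above x form a down set omitting x, so their supremum cannot reach y. -/
theorem TotallyBelow.sSup_not_le_ne {x y : V} (h : TotallyBelow x y) :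
    sSup {v | ¬ x ≤ v} ≠ y := fun he =>
  h {v | ¬ x ≤ v} (fun _ _ hvw hv hw => hv (hw.trans hvw)) he.ge le_rfl

theorem Approximated.le_of_forall (hk : Approximated k) {v : V}
    (h : ∀ u, TotallyBelow u k → u ≤ v) : k ≤ v := by
  rw [hk.2.2]
  exact sSup_le h

theorem Approximated.ne_bot (hk : Approximated k) : k ≠ ⊥ := by
  rintro rfl
  obtain ⟨u, hu⟩ := hk.1
  exact hu ∅ isLowerSet_empty bot_le

/-- An approximated element is join-prime. -/
theorem Approximated.le_or_le (hk : Approximated k) {v w : V} (h : v ⊔ w = k) :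
    k ≤ v ∨ k ≤ w := by
  by_contra! hc
  have hv : ∃ u, TotallyBelow u k ∧ ¬ u ≤ v := by
    by_contra! hv
    exact hc.1 (hk.le_of_forall hv)
  have hw : ∃ u, TotallyBelow u k ∧ ¬ u ≤ w := by
    by_contra! hw
    exact hc.2 (hk.le_of_forall hw)
  obtain ⟨u₁, hu₁, hv⟩ := hv
  obtain ⟨u₂, hu₂, hw⟩ := hw
  -- Directedness merges the two witnesses into one u ≪ k that lies below neither v nor w.
  obtain ⟨u, hu, h₁, h₂⟩ := hk.2.1 u₁ hu₁ u₂ hu₂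
  subst h
  exact (TotallyBelow.le_or_le hu).elim (fun h => hv (h₁.trans h)) fun h => hw (h₂.trans h)

end Approximation

/-! ### Elementwise descriptions -/

section Relations

variable {V : Type u} [CommMonoid V] [CompleteLattice V] [IsQuantale V] {ξ : Ultrafilter V → V}

open Quantale

theorem comp_graph {X : Type v} {Y : Type w} {Z : Type t} (r : VRel V Y Z) (f : X → Y) (x : X)
    (z : Z) : comp r (graph f) x z = r (f x) z := by
  refine le_antisymm (iSup_le fun y => ?_) ?_
  · by_cases h : f x = y
    · simp [graph, h]
    · simp [graph, h]
  · refine le_trans ?_ (le_iSup _ (f x))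
    simp [graph]

theorem under_apply {X : Type v} {Y : Type w} (r : VRel V (Ultrafilter X) Y) (x : X) (y : Y) :
    under r x y = r (pure x) y :=
  comp_graph r pure x y

omit [CommMonoid V] [IsQuantale V] in
theorem uExt_le_iff {X : Type v} {Y : Type w} {r : VRel V X Y} {p : Ultrafilter X}
    {q : Ultrafilter Y} {c : V} : uExt ξ r p q ≤ c ↔
      ∀ z : Ultrafilter (X × Y), z.map Prod.fst = p → z.map Prod.snd = q →
        ξ (z.map fun c => r c.1 c.2) ≤ c := by
  simp [uExt]

omit [CommMonoid V] [IsQuantale V] in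
theorem le_uExt {X : Type v} {Y : Type w} (r : VRel V X Y) (z : Ultrafilter (X × Y)) :
    ξ (z.map fun c => r c.1 c.2) ≤ uExt ξ r (z.map Prod.fst) (z.map Prod.snd) :=
  uExt_le_iff.1 le_rfl z rfl rfl

theorem kleisli_le_iff {X : Type v} {Y : Type w} {Z : Type t} {ψ : VRel V (Ultrafilter Y) Z}
    {φ : VRel V (Ultrafilter X) Y} {χ : VRel V (Ultrafilter X) Z} :
    kleisli ξ ψ φ ≤ χ ↔ ∀ (z : Ultrafilter (Ultrafilter X × Y)) (y : Z),
      ξ (z.map fun c => φ c.1 c.2) * ψ (z.map Prod.snd) y ≤ χ (mult (z.map Prod.fst)) y := by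
  constructor
  · intro h z y
    refine le_trans ?_ (h _ _)
    refine le_trans ?_ (le_iSup _ (z.map Prod.snd))
    gcongr
    refine le_trans ?_ (le_iSup _ (z.map Prod.fst))
    simpa [conv, graph] using le_uExt φ z
  · intro h p y
    refine iSup_le fun q => ?_
    rw [comp, iSup_mul_distrib]
    refine iSup_le fun P => ?_
    by_cases hP : mult P = p
    · subst hP
      simp only [conv, graph, if_true, one_mul]
      rw [uExt, iSup_mul_distrib]
      refine iSup_le ?_
      rintro ⟨z, rfl, rfl⟩
      exact h z y
    · simp [conv, graph, hP]

theorem le_kleisli {X : Type v} {Y : Type w} {Z : Type t} (ψ : VRel V (Ultrafilter Y) Z)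
    (φ : VRel V (Ultrafilter X) Y) (z : Ultrafilter (Ultrafilter X × Y)) (y : Z) :
    ξ (z.map fun c => φ c.1 c.2) * ψ (z.map Prod.snd) y ≤
      kleisli ξ ψ φ (mult (z.map Prod.fst)) y :=
  kleisli_le_iff.1 le_rfl z y

theorem isUCat_iff {X : Type v} {a : VRel V (Ultrafilter X) X} :
    IsUCat ξ a ↔ (∀ x, 1 ≤ a (pure x) x) ∧
      ∀ (z : Ultrafilter (Ultrafilter X × X)) (x : X),
        ξ (z.map fun c => a c.1 c.2) * a (z.map Prod.snd) x ≤ a (mult (z.map Prod.fst)) x := by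
  refine and_congr ⟨fun h x => ?_, fun h x y => ?_⟩ ⟨fun h z x => ?_, fun h P x => ?_⟩
  · simpa [comp_graph, graph] using h x x
  · rw [comp_graph]
    by_cases hxy : x = y
    · subst hxy
      simpa [graph] using h x
    · simp [graph, hxy]
  · rw [← comp_graph (V := V) a mult]
    refine le_trans ?_ (h _ _)
    refine le_trans ?_ (le_iSup _ (z.map Prod.snd))
    gcongr
    exact le_uExt a z
  · rw [comp_graph]
    refine iSup_le fun q => ?_
    rw [uExt, iSup_mul_distrib]
    refine iSup_le ?_
    rintro ⟨z, rfl, rfl⟩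
    exact h z x

theorem le_bracket_iff {X : Type v} {φ φ' : VRel V Unit X} {c : V} :
    c ≤ bracket φ φ' ↔ ∀ x, φ () x * c ≤ φ' () x := by
  simp only [bracket, le_iInf_iff, rightMulResiduation_le_iff_mul_le]

theorem mul_bracket_le {X : Type v} (φ φ' : VRel V Unit X) (x : X) :
    φ () x * bracket φ φ' ≤ φ' () x :=
  le_bracket_iff.1 le_rfl x

theorem bracket_mono_right {X : Type v} (φ : VRel V Unit X) {θ θ' : VRel V Unit X} (h : θ ≤ θ') :
    bracket φ θ ≤ bracket φ θ' :=
  le_bracket_iff.2 fun x => (mul_bracket_le φ θ x).trans (h _ _)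

theorem isVDist_vUnit {X : Type v} {a : VRel V (Ultrafilter X) X}
    {θ : VRel V Unit X} (h : ∀ x y, θ () x * a (pure x) y ≤ θ () y) :
    IsVDist (vUnit V) (under a) θ := by
  refine ⟨fun i x => iSup_le fun j => ?_, fun i x => iSup_le fun y => ?_⟩
  · simp [vUnit]
  · rw [under_apply]
    exact h y x

theorem isUDist_uUnit_iff (hk : IsTop (1 : V)) {X : Type v} {a : VRel V (Ultrafilter X) X}
    {θ : VRel V (Ultrafilter Unit) X} :
    IsUDist ξ (uUnit V) a θ ↔
      ∀ (i : Ultrafilter Unit) (p : Ultrafilter X) (x : X),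
        ξ (p.map (θ i)) * a p x ≤ θ i x := by
  constructor
  · intro h i p x
    have h₁ := kleisli_le_iff.1 h.2 (p.map fun x => (i, x)) x
    simp only [Ultrafilter.map_map, Function.comp_def, Ultrafilter.map_id'] at h₁
    rwa [Subsingleton.elim (mult (p.map fun _ => i)) i] at h₁
  · intro h
    refine ⟨kleisli_le_iff.2 fun z x => ?_, kleisli_le_iff.2 fun z x => ?_⟩
    · rw [Subsingleton.elim (mult (z.map Prod.fst)) (z.map Prod.snd)]
      calc _ ≤ 1 * θ (z.map Prod.snd) x := by gcongr; exact hk _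
        _ = _ := one_mul _
    · have h₁ := h (mult (z.map Prod.fst)) (z.map Prod.snd) x
      have h₂ : (fun c : Ultrafilter Unit × X => θ c.1 c.2) =
          θ (mult (z.map Prod.fst)) ∘ Prod.snd :=
        funext fun c => by rw [Subsingleton.elim c.1 (mult (z.map Prod.fst))]; rfl
      rwa [Ultrafilter.map_map, ← h₂] at h₁

end Relations

/-! ### The reflection -/

section Reflection

variable {V : Type u} [CommMonoid V] [CompleteLattice V] [IsQuantale V] {ξ : Ultrafilter V → V}
  {X : Type v} {a : VRel V (Ultrafilter X) X} {φ : VRel V Unit X}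

open Quantale

theorem isUDist_sInf (hsup : CompatibleWithFiniteSuprema ξ) (hk : IsTop (1 : V))
    {S : Set (VRel V (Ultrafilter Unit) X)} (hS : ∀ θ ∈ S, IsUDist ξ (uUnit V) a θ) :
    IsUDist ξ (uUnit V) a (sInf S) := by
  rw [isUDist_uUnit_iff hk]
  intro i p x
  have hle : ∀ θ ∈ S, sInf S ≤ θ := fun θ hθ => sInf_le hθ
  have : sInf S i x = ⨅ θ : S, θ.1 i x := by simp [sInf_apply, iInf_apply]
  rw [this]
  refine le_iInf fun θ => le_trans ?_ ((isUDist_uUnit_iff hk).1 (hS θ.1 θ.2) i p x)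
  gcongr
  exact xi_map_mono hsup p (hle θ.1 θ.2 i)

/-- Cotensors of `U`-distributors. -/
theorem isUDist_residuation (hξ : IsStrictUltrafilterTheory ξ)
    (hsup : CompatibleWithFiniteSuprema ξ) (hk : IsTop (1 : V)) (u : V)
    {θ : VRel V (Ultrafilter Unit) X} (hθ : IsUDist ξ (uUnit V) a θ) :
    IsUDist ξ (uUnit V) a fun i x => u ⇨ᵣ θ i x := by
  rw [isUDist_uUnit_iff hk] at hθ ⊢
  intro i p x
  rw [rightMulResiduation_le_iff_mul_le, ← mul_assoc]
  refine le_trans ?_ (hθ i p x)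
  gcongr
  -- Strictness moves u, viewed as a constant function, inside ξ.
  calc u * ξ (p.map fun x => u ⇨ᵣ θ i x)
      = ξ (p.map fun x => u * (u ⇨ᵣ θ i x)) := by
        rw [xi_map_mul hξ, xi_map_const hξ.toIsUltrafilterTheory]
    _ ≤ ξ (p.map (θ i)) :=
        xi_map_mono hsup p fun x => rightMulResiduation_le_iff_mul_le.1 le_rfl

theorem le_under_reflection : φ ≤ under (reflection ξ a φ) := by
  intro i x
  rw [under_apply, reflection]
  simp only [sInf_apply, iInf_apply, le_iInf_iff, Subtype.forall]
  rintro θ ⟨-, hθ⟩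
  have := hθ i x
  rwa [under_apply] at this

omit [IsQuantale V] in
theorem reflection_le {θ : VRel V (Ultrafilter Unit) X} (hθ : IsUDist ξ (uUnit V) a θ)
    (h : φ ≤ under θ) : reflection ξ a φ ≤ θ :=
  sInf_le ⟨hθ, h⟩

theorem isUDist_reflection (hsup : CompatibleWithFiniteSuprema ξ) (hk : IsTop (1 : V)) :
    IsUDist ξ (uUnit V) a (reflection ξ a φ) :=
  isUDist_sInf hsup hk fun _ h => h.1

theorem isReflection_reflection (hξ : IsStrictUltrafilterTheory ξ)
    (hsup : CompatibleWithFiniteSuprema ξ) (hk : IsTop (1 : V)) :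
    IsReflection ξ a φ (reflection ξ a φ) where
  dist := isUDist_reflection hsup hk
  bracket_eq θ hθ := by
    apply le_antisymm
    · refine le_bracket_iff.2 fun x => le_trans ?_
        (mul_bracket_le (under (reflection ξ a φ)) (under θ) x)
      gcongr
      exact le_under_reflection () x
    · refine le_bracket_iff.2 fun x => ?_
      -- The cotensor of θ by [φ, θ] is a U-distributor above φ, hence above the reflection.
      have h := reflection_le (φ := φ)
        (isUDist_residuation hξ hsup hk (bracket φ (under θ)) hθ) fun i x => ?_
      · rw [under_apply, under_apply, mul_comm]
        exact rightMulResiduation_le_iff_mul_le.1 (h (pure ()) x)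
      · rw [under_apply, rightMulResiduation_le_iff_mul_le, mul_comm, ← under_apply θ]
        exact mul_bracket_le φ (under θ) x

end Reflection

/-! ### The adjunction -/

section Adjunction

variable {V : Type u} [CommMonoid V] [CompleteLattice V] [IsQuantale V] {ξ : Ultrafilter V → V}
  {X : Type u} {a : VRel V (Ultrafilter X) X} {φ : VRel V Unit X}

theorem IsUCat.one_le (ha : IsUCat ξ a) (x : X) : 1 ≤ a (pure x) x :=
  (isUCat_iff.1 ha).1 x

theorem IsUCat.trans_mult (ha : IsUCat ξ a) (z : Ultrafilter (Ultrafilter X × X)) (x : X) :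
    ξ (z.map fun c => a c.1 c.2) * a (z.map Prod.snd) x ≤ a (mult (z.map Prod.fst)) x :=
  (isUCat_iff.1 ha).2 z x

/-- Transitivity with first coordinate constantly p: it makes a(p,-) a U-distributor G → X. -/
theorem IsUCat.xi_mul_le (ha : IsUCat ξ a) (p q : Ultrafilter X) (x : X) :
    ξ (q.map (a p)) * a q x ≤ a p x := by
  have h := ha.trans_mult (q.map fun y => (p, y)) x
  simp only [Ultrafilter.map_map, Function.comp_def, Ultrafilter.map_id'] at h
  rwa [map_const_eq_pure, mult_pure] at h

theorem IsUCat.trans_pure (hξ : IsUltrafilterTheory ξ) (ha : IsUCat ξ a) (p : Ultrafilter X)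
    (x y : X) : a p x * a (pure x) y ≤ a p y := by
  have h := ha.xi_mul_le p (pure x) y
  rwa [xi_map_pure hξ] at h

/-- Transitivity with second coordinate constantly x, where reflexivity removes the other factor. -/
theorem IsUCat.xi_le_mult (ha : IsUCat ξ a) (P : Ultrafilter (Ultrafilter X)) (x : X) :
    ξ (P.map fun p => a p x) ≤ a (mult P) x := by
  have h := ha.trans_mult (P.map fun p => (p, x)) x
  simp only [Ultrafilter.map_map, Function.comp_def, Ultrafilter.map_id'] at h
  rw [map_const_eq_pure] at h
  refine le_trans ?_ h
  conv_lhs => rw [← mul_one (ξ _)]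
  gcongr
  exact ha.one_le x

/-- The candidate right adjoint `p ↦ [φ, a(p, -)]` of the reflection of `φ`. -/
noncomputable def rightAdj (a : VRel V (Ultrafilter X) X) (φ : VRel V Unit X) :
    VRel V (Ultrafilter X) Unit :=
  fun p _ => bracket φ fun _ x => a p x

theorem mul_rightAdj_le (p : Ultrafilter X) (x : X) : φ () x * rightAdj a φ p () ≤ a p x :=
  mul_bracket_le φ (fun _ x => a p x) x

theorem le_rightAdj_iff {p : Ultrafilter X} {c : V} :
    c ≤ rightAdj a φ p () ↔ ∀ x, φ () x * c ≤ a p x :=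
  le_bracket_iff

theorem reflection_mul_rightAdj_le (hξ : IsStrictUltrafilterTheory ξ)
    (hsup : CompatibleWithFiniteSuprema ξ) (hk : IsTop (1 : V)) (ha : IsUCat ξ a)
    (i : Ultrafilter Unit) (p : Ultrafilter X) (x : X) :
    reflection ξ a φ i x * rightAdj a φ p () ≤ a p x := by
  have hθ : IsUDist ξ (uUnit V) a fun _ x => a p x :=
    (isUDist_uUnit_iff hk).2 fun _ q x => ha.xi_mul_le p q x
  have h := (isReflection_reflection (φ := φ) hξ hsup hk).bracket_eq _ hθ
  have hu : (under fun _ x => a p x : VRel V Unit X) = fun _ x => a p x := by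
    funext _ x
    rw [under_apply]
  rw [hu] at h
  rw [rightAdj, ← h, Subsingleton.elim i (pure ()), ← under_apply (reflection ξ a φ)]
  exact mul_bracket_le (under (reflection ξ a φ)) (fun _ x => a p x) x

theorem xi_rightAdj_le (hξ : IsStrictUltrafilterTheory ξ) (hsup : CompatibleWithFiniteSuprema ξ)
    (ha : IsUCat ξ a) (P : Ultrafilter (Ultrafilter X)) :
    ξ (P.map fun p => rightAdj a φ p ()) ≤ rightAdj a φ (mult P) () := by
  refine le_rightAdj_iff.2 fun x => le_trans ?_ (ha.xi_le_mult P x)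
  calc φ () x * ξ (P.map fun p => rightAdj a φ p ())
      = ξ (P.map fun p => φ () x * rightAdj a φ p ()) := by
        rw [xi_map_mul hξ, xi_map_const hξ.toIsUltrafilterTheory]
    _ ≤ ξ (P.map fun p => a p x) := xi_map_mono hsup P fun p => mul_rightAdj_le p x

theorem xi_mul_rightAdj_le (ha : IsUCat ξ a) (z : Ultrafilter (Ultrafilter X × X)) :
    ξ (z.map fun c => a c.1 c.2) * rightAdj a φ (z.map Prod.snd) () ≤
      rightAdj a φ (mult (z.map Prod.fst)) () := by
  refine le_rightAdj_iff.2 fun x => le_trans ?_ (ha.trans_mult z x)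
  rw [mul_left_comm]
  gcongr
  exact mul_rightAdj_le _ x

theorem isUDist_rightAdj (hξ : IsStrictUltrafilterTheory ξ)
    (hsup : CompatibleWithFiniteSuprema ξ) (ha : IsUCat ξ a) :
    IsUDist ξ a (uUnit V) (rightAdj a φ) := by
  refine ⟨kleisli_le_iff.2 fun z _ => xi_mul_rightAdj_le ha z, kleisli_le_iff.2 fun z _ => ?_⟩
  have h := xi_rightAdj_le (φ := φ) hξ hsup ha (z.map Prod.fst)
  rw [Ultrafilter.map_map] at h
  simp only [uUnit, mul_one]
  exact h

/-- A composite through one point: the principal ultrafilter at (p, ()) attains the supremum, and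
the distributor law of ψ bounds all other terms. -/
theorem kleisli_reflection_rightAdj (hξ : IsStrictUltrafilterTheory ξ)
    (hsup : CompatibleWithFiniteSuprema ξ) (ha : IsUCat ξ a) :
    kleisli ξ (reflection ξ a φ) (rightAdj a φ) =
      fun p x => rightAdj a φ p () * reflection ξ a φ (pure ()) x := by
  apply le_antisymm
  · refine kleisli_le_iff.2 fun z x => ?_
    rw [Subsingleton.elim (z.map Prod.snd) (pure ())]
    gcongr
    have h := xi_rightAdj_le (φ := φ) hξ hsup ha (z.map Prod.fst)
    rwa [Ultrafilter.map_map] at h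
  · intro p x
    have h := le_kleisli (ξ := ξ) (reflection ξ a φ) (rightAdj a φ) (pure (p, ())) x
    rwa [xi_map_pure hξ.toIsUltrafilterTheory, Ultrafilter.map_pure, Ultrafilter.map_pure,
      mult_pure] at h

theorem isUDist_mul (hξ : IsStrictUltrafilterTheory ξ) (hk : IsTop (1 : V))
    {ψ : VRel V (Ultrafilter X) Unit} {θ : VRel V (Ultrafilter Unit) X}
    (hψ : IsUDist ξ a (uUnit V) ψ) (hθ : IsUDist ξ (uUnit V) a θ) :
    IsUDist ξ a a fun p x => ψ p () * θ (pure ()) x := by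
  refine ⟨kleisli_le_iff.2 fun z x => ?_, kleisli_le_iff.2 fun z x => ?_⟩
  · rw [← mul_assoc]
    gcongr
    exact kleisli_le_iff.1 hψ.1 z ()
  · rw [xi_map_mul hξ, mul_assoc]
    have h₁ := kleisli_le_iff.1 hψ.2 (z.map fun c => (c.1, ())) ()
    have h₂ := (isUDist_uUnit_iff hk).1 hθ (pure ()) (z.map Prod.snd) x
    simp only [Ultrafilter.map_map, Function.comp_def, uUnit, mul_one] at h₁ h₂
    exact mul_le_mul' h₁ h₂

theorem isUAdjunction_of_unit_le (hξ : IsStrictUltrafilterTheory ξ)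
    (hsup : CompatibleWithFiniteSuprema ξ) (hk : IsTop (1 : V)) (ha : IsUCat ξ a)
    (hunit : uUnit V ≤ kleisli ξ (rightAdj a φ) (reflection ξ a φ)) :
    IsUAdjunction ξ (uUnit V) a (reflection ξ a φ) (rightAdj a φ) where
  left_dist := isUDist_reflection hsup hk
  right_dist := isUDist_rightAdj hξ hsup ha
  comp_left_dist := by
    have h : kleisli ξ (rightAdj a φ) (reflection ξ a φ) = uUnit V :=
      le_antisymm (fun _ _ => hk _) hunit
    rw [h]
    exact ⟨fun _ _ => hk _, fun _ _ => hk _⟩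
  comp_right_dist := by
    rw [kleisli_reflection_rightAdj hξ hsup ha]
    exact isUDist_mul hξ hk (isUDist_rightAdj hξ hsup ha) (isUDist_reflection hsup hk)
  unit_le := hunit
  counit_le := by
    rw [kleisli_reflection_rightAdj hξ hsup ha]
    intro p x
    refine (mul_comm _ _).trans_le ?_
    exact reflection_mul_rightAdj_le hξ hsup hk ha _ p x

end Adjunction

/-! ### The unit of the adjunction -/

section AdjunctionUnit

variable {V : Type u} [CommMonoid V] [CompleteLattice V] [IsQuantale V] {ξ : Ultrafilter V → V}
  {X : Type u} {a : VRel V (Ultrafilter X) X} {φ : VRel V Unit X}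

open Quantale

/-- The closure of the restriction of `φ` to the subset `A`. -/
noncomputable def partClosure (ξ : Ultrafilter V → V) (a : VRel V (Ultrafilter X) X)
    (φ : VRel V Unit X) (A : Set X) : VRel V Unit X :=
  fun i y => ⨆ q : {q : Ultrafilter X // A ∈ q}, ξ (q.1.map (φ i)) * a q.1 y

theorem isVDist_partClosure (hξ : IsUltrafilterTheory ξ)
    (ha : IsUCat ξ a) (A : Set X) : IsVDist (vUnit V) (under a) (partClosure ξ a φ A) := by
  refine isVDist_vUnit fun x y => ?_
  rw [partClosure, iSup_mul_distrib]
  refine iSup_mono fun q => ?_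
  rw [mul_assoc]
  gcongr
  exact ha.trans_pure hξ _ x y

omit [IsQuantale V] in
theorem partClosure_mono {A B : Set X} (h : A ⊆ B) :
    partClosure ξ a φ A ≤ partClosure ξ a φ B := fun i y =>
  iSup_le fun q => le_iSup (fun q : {q : Ultrafilter X // B ∈ q} => ξ (q.1.map (φ i)) * a q.1 y)
    ⟨q.1, Filter.mem_of_superset q.2 h⟩

omit [IsQuantale V] in
theorem partClosure_empty : partClosure ξ a φ ∅ = ⊥ := by
  funext i y
  exact le_bot_iff.1 (iSup_le fun q => (q.1.empty_notMem q.2).elim)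

omit [IsQuantale V] in
theorem partClosure_union (A B : Set X) :
    partClosure ξ a φ (A ∪ B) = partClosure ξ a φ A ⊔ partClosure ξ a φ B := by
  refine le_antisymm (fun i y => iSup_le fun q => ?_)
    (sup_le (partClosure_mono Set.subset_union_left) (partClosure_mono Set.subset_union_right))
  rcases Ultrafilter.union_mem_iff.1 q.2 with h | h
  · exact le_sup_of_le_left (le_iSup
      (fun q : {q : Ultrafilter X // A ∈ q} => ξ (q.1.map (φ i)) * a q.1 y) ⟨q.1, h⟩)
  · exact le_sup_of_le_right (le_iSup
      (fun q : {q : Ultrafilter X // B ∈ q} => ξ (q.1.map (φ i)) * a q.1 y) ⟨q.1, h⟩)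

theorem le_partClosure_univ (hξ : IsUltrafilterTheory ξ) (ha : IsUCat ξ a) :
    φ ≤ partClosure ξ a φ Set.univ := by
  intro i x
  refine le_trans ?_ (le_iSup _ ⟨pure x, Filter.univ_mem⟩)
  rw [xi_map_pure hξ]
  conv_lhs => rw [← mul_one (φ i x)]
  gcongr
  exact ha.one_le x

/-- The constant w is w ⊗ k, and the constant k is a distributor because k is top. -/
theorem bracket_const (hk : IsTop (1 : V)) (hφ : IsCodirected (under a) φ) (w : V) :
    bracket φ (fun _ _ => w) = w := by
  have h := hφ.bracket_tensor w (fun _ _ => 1) (isVDist_vUnit fun x y => hk _)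
  have h₁ : bracket φ (fun _ _ => 1) = 1 :=
    le_antisymm (hk _) (le_bracket_iff.2 fun x => hk _)
  rwa [h₁, mul_one] at h

theorem bracket_partClosure_le (hξ : IsUltrafilterTheory ξ)
    (hsup : CompatibleWithFiniteSuprema ξ) (hk : IsTop (1 : V))
    (hφ : IsCodirected (under a) φ) {A : Set X} {w : V} (hA : ∀ x ∈ A, φ () x ≤ w) :
    bracket φ (partClosure ξ a φ A) ≤ w := by
  refine le_trans (bracket_mono_right φ fun i y => iSup_le fun q => ?_)
    (bracket_const hk hφ w).le
  calc ξ (q.1.map (φ i)) * a q.1 y ≤ w * 1 :=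
        mul_le_mul' (xi_map_le hξ hsup (Filter.mem_of_superset q.2 hA)) (hk _)
    _ = w := mul_one w

/-- A codirected distributor is represented by an ultrafilter. -/
theorem IsCodirected.exists_ultrafilter (hξ : IsUltrafilterTheory ξ)
    (hsup : CompatibleWithFiniteSuprema ξ) (hk : IsTop (1 : V)) (happ : Approximated (1 : V))
    (ha : IsUCat ξ a) (hφ : IsCodirected (under a) φ) :
    ∃ p : Ultrafilter X, 1 ≤ ξ (p.map (φ ())) ∧ ∀ x, φ () x ≤ a p x := by
  set μ : Set X → V := fun A => bracket φ (partClosure ξ a φ A) with hμ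
  have hμ_mono : ∀ ⦃A B : Set X⦄, A ⊆ B → μ A ≤ μ B := fun A B h =>
    bracket_mono_right φ (partClosure_mono h)
  have hμ_univ : 1 ≤ μ Set.univ := le_bracket_iff.2 fun x => by
    rw [mul_one]
    exact le_partClosure_univ hξ ha () x
  let F : Filter X := Filter.comk (fun A => ¬ 1 ≤ μ A)
    (by
      have : μ ∅ = ⊥ := by simp only [hμ]; rw [partClosure_empty, hφ.bracket_bot]
      rw [this]
      exact fun h => happ.ne_bot (le_bot_iff.1 h))
    (fun B hB A hAB h => hB (h.trans (hμ_mono hAB)))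
    (fun A hA B hB h => by
      have : μ (A ∪ B) = μ A ⊔ μ B := by
        simp only [hμ]
        rw [partClosure_union, hφ.bracket_sup _ _ (isVDist_partClosure hξ ha A)
          (isVDist_partClosure hξ ha B)]
      exact (happ.le_or_le ((this.symm.trans (le_antisymm (hk _) h)))).elim hA hB)
  have hF : F.NeBot := ⟨fun h => by
    have : ∅ ∈ F := h ▸ Filter.mem_bot
    rw [Filter.mem_comk, Set.compl_empty] at this
    exact this hμ_univ⟩
  obtain ⟨p, hp⟩ := Ultrafilter.exists_le F
  have hpμ : ∀ A ∈ p, 1 ≤ μ A := by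
    intro A hA
    by_contra h
    have : Aᶜ ∈ p := hp (by rwa [Filter.mem_comk, compl_compl])
    exact Ultrafilter.compl_mem_iff_notMem.1 this hA
  refine ⟨p, happ.le_of_forall fun u hu => ?_, fun x => ?_⟩
  · refine le_xi_map hξ hsup ?_
    by_contra h
    -- On the set where φ is not above u, φ is bounded by the supremum of all v not above u. That
    -- would bound μ = k by an element different from k.
    have h₁ := hpμ _ (Ultrafilter.compl_mem_iff_notMem.2 h)
    refine hu.sSup_not_le_ne (le_antisymm (hk _) (h₁.trans ?_))
    exact bracket_partClosure_le hξ hsup hk hφ fun x hx => le_sSup hx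
  -- 𝓕 is chosen so that every ultrafilter P refining it has `mult P = p`.
  · let 𝓕 : Filter (Ultrafilter X) := ⨅ A ∈ p, Filter.principal {q | A ∈ q}
    have hmem : ∀ B ∈ 𝓕, ∃ A ∈ p, {q : Ultrafilter X | A ∈ q} ⊆ B := by
      intro B hB
      have hdir : DirectedOn ((fun A : Set X => Filter.principal {q : Ultrafilter X | A ∈ q}) ⁻¹'o (· ≥ ·))
          {A | A ∈ p} := fun A hA A' hA' =>
        ⟨A ∩ A', Filter.inter_mem hA hA',
          Filter.principal_mono.2 fun q hq => Filter.mem_of_superset hq Set.inter_subset_left,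
          Filter.principal_mono.2 fun q hq => Filter.mem_of_superset hq Set.inter_subset_right⟩
      simpa using (Filter.mem_biInf_of_directed hdir ⟨Set.univ, Filter.univ_mem⟩).1 hB
    refine le_trans ?_ ((iInf_iSup_le_iSup_xi hξ hsup 𝓕 fun q => a q x).trans (iSup_le ?_))
    · refine le_iInf₂ fun B hB => ?_
      obtain ⟨A, hA, hAB⟩ := hmem B hB
      -- μ(A) = k says that φ lies below its closure on A, hence below the supremum of a(q,-) over q
      -- containing A.
      have h := (mul_le_mul' le_rfl (hpμ A hA)).trans (mul_bracket_le φ (partClosure ξ a φ A) x)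
      rw [mul_one] at h
      refine h.trans (iSup_le fun q => ?_)
      calc ξ (q.1.map (φ ())) * a q.1 x ≤ 1 * a q.1 x := mul_le_mul' (hk _) le_rfl
        _ = a q.1 x := one_mul _
        _ ≤ _ := le_iSup₂ (f := fun q (_ : q ∈ B) => a q x) q.1 (hAB q.2)
    · rintro ⟨P, hP⟩
      have hmult : mult P = p := Ultrafilter.eq_of_le fun A hA => (mem_mult P A).2
        (hP (Filter.mem_iInf_of_mem A (Filter.mem_iInf_of_mem hA (Filter.mem_principal_self _))))
      exact hmult ▸ ha.xi_le_mult P x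

theorem uUnit_le_kleisli (hξ : IsUltrafilterTheory ξ)
    (hsup : CompatibleWithFiniteSuprema ξ) (hk : IsTop (1 : V)) (happ : Approximated (1 : V))
    (ha : IsUCat ξ a) (hφ : IsCodirected (under a) φ) :
    uUnit V ≤ kleisli ξ (rightAdj a φ) (reflection ξ a φ) := by
  obtain ⟨p, hp, hpa⟩ := hφ.exists_ultrafilter hξ hsup hk happ ha
  intro i _
  -- The copy of p on U1 × X contributes a term of the composite that is already at least k.
  have h := le_kleisli (ξ := ξ) (rightAdj a φ) (reflection ξ a φ)
    (p.map fun x => (pure (), x)) ()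
  rw [Subsingleton.elim (mult _) i] at h
  refine le_trans ?_ h
  simp only [Ultrafilter.map_map, Function.comp_def, Ultrafilter.map_id', uUnit]
  rw [← mul_one (1 : V)]
  refine mul_le_mul' (hp.trans (xi_map_mono hsup p fun x => ?_))
    (le_rightAdj_iff.2 fun x => by rw [mul_one]; exact hpa x)
  rw [← under_apply (reflection ξ a φ)]
  exact le_under_reflection () x

end AdjunctionUnit

end UTheory

theorem corollaryd {V : Type u} [CommMonoid V] [CompleteLattice V] [IsQuantale V]
    (ξ : Ultrafilter V → V) (hξ : IsStrictUltrafilterTheory ξ)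
    (hsup : CompatibleWithFiniteSuprema ξ)
    (hk : IsTop (1 : V)) (happ : Approximated (1 : V))
    {X : Type u} (a : VRel V (Ultrafilter X) X) (ha : IsUCat ξ a)
    (φ : VRel V Unit X) (hφ : IsCodirected (under a) φ) :
    IsReflection ξ a φ (reflection ξ a φ) ∧
      IsLeftAdjointUDist ξ (uUnit V) a (reflection ξ a φ) := by
  exact ⟨isReflection_reflection hξ hsup hk, rightAdj a φ,
    isUAdjunction_of_unit_le hξ hsup hk ha
      (uUnit_le_kleisli hξ.toIsUltrafilterTheory hsup hk happ ha hφ)⟩
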